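/- Let $0<\alpha\le 2$, let $X,X_1,X_2,\dots$ be independent and identically distributed real random variables, let $S_n=\sum_{i=1}^n X_i$, and let $\varphi_X(t)=\mathbb{E}\,e^{\mathrm{i}tX}$. The following are equivalent. (i) $S_n/n^{1/\alpha}$ converges in distribution, as $n\to\infty$, to some non-degenerate (that is, not almost surely constant) real random variable $Z$. (ii) There are real numbers $\kappa>0$ and $\lambda$ such that $$\varphi_X(t)=1-(\kappa-\mathrm{i}\lambda)t^\alpha+o(t^\alpha)\qquad\text{as } t\downarrow 0 .$$ Moreover, if these hold, with $Z$ as in (i) and $\kappa,\lambda$ as in (ii), then $Z$ is strictly $\alpha$-stable, which means that $Z$ is non-degenerate and that, for every $n\ge1$, the sum of $n$ independent copies of $Z$ has the same distribution as $n^{1/\alpha}Z$; the characteristic function of $Z$ is $$\varphi_Z(t)=\exp\bigl(-(\kappa-\mathrm{i}\lambda)t^\alpha\bigr),\qquad t\ge0;$$ and, if $\alpha\ne1$, then $|\lambda|\le\kappa\,\bigl|\tan\tfrac{\pi\alpha}{2}\bigr|$ (for $\alpha=1$ there is no restriction on $\lambda$; for $\alpha=2$ the bound says that $\lambda=0$).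 -/

import Mathlib

open MeasureTheory ProbabilityTheory Filter Asymptotics
open scoped Topology

/-- A real random variable `Z` is non-degenerate: it is not a.s. equal to a constant. -/
def IsNondegenerate {Ω : Type*} [MeasurableSpace Ω] (Z : Ω → ℝ) (P : Measure Ω) : Prop :=
  ∀ c : ℝ, ¬ Z =ᵐ[P] fun _ => c

/-- The law of `Z₁ + ⋯ + Zₙ`, where `Z₁, …, Zₙ` are i.i.d. with law `ν`. -/
noncomputable def iidSumLaw (ν : Measure ℝ) (n : ℕ) : Measure ℝ :=
  (Measure.pi fun _ : Fin n => ν).map fun z => ∑ i, z i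

/-- The law `ν` on `ℝ` is stable with norming constants `a n` and centring constants `b n`:
it is non-degenerate and, for every `n ≥ 1`, the sum of `n` i.i.d. copies of a variable `Z`
with law `ν` has the law of `a n * Z + b n`, where `a n > 0`. -/
structure IsStableWith (ν : Measure ℝ) (a b : ℕ → ℝ) : Prop where
  nondegenerate : IsNondegenerate (fun x : ℝ => x) ν
  pos : ∀ n : ℕ, 1 ≤ n → 0 < a n
  sum_law : ∀ n : ℕ, 1 ≤ n → iidSumLaw ν n = ν.map fun x => a n * x + b n

/-- The random variable `Z` is strictly `α`-stable: its law is stable, with norming constants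
`n ^ (1 / α)` and with vanishing centring constants. -/
def IsStrictlyStable {Ω : Type*} [MeasurableSpace Ω] (Z : Ω → ℝ) (P : Measure Ω) (α : ℝ) :
    Prop :=
  IsStableWith (P.map Z) (fun n => (n : ℝ) ^ (1 / α)) (fun _ => 0)

/-- `φ_Y(t) = 1 - (κ - iμ) t ^ α + o(t ^ α)` as `t ↓ 0`, for the characteristic function
`φ_Y(t) = E[exp (itY)]` of the random variable `Y`. -/
def HasCharFunExpansion {Ω : Type*} [MeasurableSpace Ω] (Y : Ω → ℝ) (P : Measure Ω)
    (α κ μ : ℝ) : Prop :=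
  (fun t : ℝ => charFun (P.map Y) t - (1 - ((κ : ℂ) - Complex.I * μ) * ((t ^ α : ℝ) : ℂ)))
    =o[𝓝[>] (0 : ℝ)] fun t : ℝ => t ^ α

/-! Write c = κ - iλ (λ is `μ` in the code). The characteristic function of S_n / n^{1/α} at t is
φ_X(n^{-1/α} t)^n. Under (ii) it tends to exp(-c t^α) for t ≥ 0 (`tendsto_pow_of_expansion`); Lévy's
continuity theorem then gives (i) and the form of φ_Z, from which strict stability is read off.

Conversely, weak convergence makes these characteristic functions asymptotically equicontinuous, so
on one interval [0, δ] and for all large n their logarithm is n log φ_X(n^{-1/α} t). To control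
φ_X(s) for every s ↓ 0, and not only along a sequence, take n = ⌊(δ/s)^α⌋
(`exists_expansion_of_tendsto`). Non-degeneracy forces Re c > 0.

The bound on λ comes from a Laplace transform: σ² ∫ e^{-σt} (1 - φ(t)) dt has nonnegative real part
when Re σ > 0. For n^{-1/α} Z, after multiplication by n, it converges to Γ(α+1) c σ^{1-α}; letting
arg σ tend to ±π/2 gives the two inequalities. -/

/-! ### Laplace transforms and the bound on λ. -/

theorem integrableOn_rpow_mul_exp_neg_mul_Ioi {a b : ℝ} (ha : -1 < a) (hb : 0 < b) :
    IntegrableOn (fun t : ℝ => t ^ a * Real.exp (-(b * t))) (Set.Ioi 0) := by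
  simpa using integrableOn_rpow_mul_exp_neg_mul_rpow (p := 1) ha zero_lt_one hb

/-- The Laplace transform of a power, at complex points of the right half-plane. -/
theorem integral_rpow_mul_cexp_neg_mul_Ioi {a : ℝ} (ha : 0 < a) {σ : ℂ} (hσ : 0 < σ.re) :
    ∫ t in Set.Ioi (0 : ℝ), ((t ^ a : ℝ) : ℂ) * Complex.exp (-(σ * t)) =
      (Real.Gamma (a + 1) : ℂ) * σ ^ (-(a + 1 : ℂ)) := by
  -- With density t^a on the half-line, the integral is an analytic moment generating function at z
  -- = -σ. The identity theorem extends the real Gamma integral from the negative axis to Re z < 0.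
  set ρ : Measure ℝ := (volume.restrict (Set.Ioi 0)).withDensity
    (fun t => ((t ^ a).toNNReal : ENNReal)) with hρ
  have hmeas : Measurable fun t : ℝ => (t ^ a).toNNReal := by fun_prop
  have key : ∀ z : ℂ, complexMGF id ρ z =
      ∫ t in Set.Ioi (0 : ℝ), ((t ^ a : ℝ) : ℂ) * Complex.exp (z * t) := by
    intro z
    rw [complexMGF, hρ, integral_withDensity_eq_integral_smul hmeas]
    refine setIntegral_congr_fun measurableSet_Ioi fun t ht => ?_
    have : 0 ≤ t ^ a := Real.rpow_nonneg (le_of_lt ht) a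
    simp [NNReal.smul_def, this]
  have hset : Set.Iio 0 ⊆ integrableExpSet id ρ := by
    intro x hx
    rw [integrableExpSet, Set.mem_ofPred_eq, hρ, integrable_withDensity_iff_integrable_smul hmeas]
    refine IntegrableOn.congr_fun
      (integrableOn_rpow_mul_exp_neg_mul_Ioi (a := a) (b := -x) (by linarith) (by simpa using hx))
      (fun t ht => ?_) measurableSet_Ioi
    have : 0 ≤ t ^ a := Real.rpow_nonneg (le_of_lt ht) a
    simp [NNReal.smul_def, this]
  have hint : ∀ z : ℂ, z.re < 0 → z.re ∈ interior (integrableExpSet id ρ) := fun z hz =>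
    interior_mono hset (by simpa using hz)
  have hL : AnalyticOnNhd ℂ (complexMGF id ρ) {z | z.re < 0} :=
    analyticOnNhd_complexMGF.mono hint
  have hR : AnalyticOnNhd ℂ
      (fun z : ℂ => (Real.Gamma (a + 1) : ℂ) * (-z) ^ (-(a + 1 : ℂ))) {z | z.re < 0} := by
    intro z hz
    refine analyticAt_const.mul (AnalyticAt.cpow analyticAt_id.neg analyticAt_const ?_)
    exact Or.inl (by simpa using hz)
  have hreal : ∀ x : ℝ, x < 0 → complexMGF id ρ (x : ℂ) =
      (Real.Gamma (a + 1) : ℂ) * (-(x : ℂ)) ^ (-(a + 1 : ℂ)) := by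
    intro x hx
    rw [key]
    have h := Real.integral_rpow_mul_exp_neg_mul_Ioi (a := a + 1) (r := -x) (by linarith)
      (by linarith)
    have h' : ∫ t in Set.Ioi (0 : ℝ), ((t ^ a : ℝ) : ℂ) * Complex.exp (x * t) =
        ((∫ t in Set.Ioi (0 : ℝ), t ^ (a + 1 - 1) * Real.exp (-(-x * t)) : ℝ) : ℂ) := by
      rw [← integral_complex_ofReal]
      refine setIntegral_congr_fun measurableSet_Ioi fun t _ => ?_
      simp
    rw [h', h, one_div, Real.inv_rpow (by linarith), ← Real.rpow_neg (by linarith), mul_comm]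
    push_cast
    rw [Complex.ofReal_cpow (by linarith)]
    push_cast
    rfl
  have hpre : IsPreconnected {z : ℂ | z.re < 0} :=
    (convex_halfSpace_re_lt 0).isPreconnected
  have hfreq : ∃ᶠ z in 𝓝[≠] ((-1 : ℝ) : ℂ), complexMGF id ρ z =
      (Real.Gamma (a + 1) : ℂ) * (-z) ^ (-(a + 1 : ℂ)) := by
    have ht : Tendsto (fun x : ℝ => (x : ℂ)) (𝓝[≠] (-1)) (𝓝[≠] ((-1 : ℝ) : ℂ)) :=
      Complex.continuous_ofReal.continuousAt.continuousWithinAt.tendsto_nhdsWithin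
        fun x hx => by
          simp only [Set.mem_compl_iff, Set.mem_singleton_iff] at hx ⊢
          exact_mod_cast hx
    refine ht.frequently (Eventually.frequently ?_)
    filter_upwards [nhdsWithin_le_nhds (Iio_mem_nhds (show (-1 : ℝ) < 0 by norm_num))] with x hx
    exact hreal x hx
  have := hL.eqOn_of_preconnected_of_frequently_eq hR hpre
    (z₀ := ((-1 : ℝ) : ℂ)) (by simp) hfreq (show (-σ) ∈ {z : ℂ | z.re < 0} by simpa using hσ)
  rw [key] at this
  simpa using this

/-- For `Re σ > 0`, the number `σ² ∫₀^∞ e^{-σt} (1 - φ(t)) dt` has nonnegative real part, for every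
characteristic function `φ`. -/
theorem re_sq_mul_laplace_one_sub_charFun_nonneg (ν : Measure ℝ) [IsProbabilityMeasure ν] {σ : ℂ}
    (hσ : 0 < σ.re) :
    0 ≤ (σ ^ 2 * ∫ t in Set.Ioi (0 : ℝ), Complex.exp (-(σ * t)) * (1 - charFun ν t)).re := by
  have hσ0 : σ ≠ 0 := by rintro rfl; simp at hσ
  have hchar : ∀ t : ℝ, 1 - charFun ν t = ∫ x, (1 - Complex.exp (t * x * Complex.I)) ∂ν := by
    intro t
    rw [integral_sub (integrable_const _), charFun_apply_real]
    · simp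
    · refine (integrable_const (1 : ℝ)).mono' (by fun_prop) (ae_of_all _ fun x => ?_)
      rw [← Complex.ofReal_mul, Complex.norm_exp_ofReal_mul_I]
  have hprod : Integrable (Function.uncurry fun (t x : ℝ) =>
      Complex.exp (-(σ * t)) * (1 - Complex.exp (t * x * Complex.I)))
      ((volume.restrict (Set.Ioi (0 : ℝ))).prod ν) := by
    have hb : Integrable (fun p : ℝ × ℝ => (2 * Real.exp (-σ.re * p.1)) * 1)
        ((volume.restrict (Set.Ioi (0 : ℝ))).prod ν) :=
      Integrable.mul_prod ((exp_neg_integrableOn_Ioi 0 hσ).const_mul 2) (integrable_const (1 : ℝ))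
    refine hb.mono' (by unfold Function.uncurry; fun_prop) (ae_of_all _ fun p => ?_)
    simp only [Function.uncurry]
    rw [norm_mul, Complex.norm_exp]
    have h1 : ‖1 - Complex.exp (p.1 * p.2 * Complex.I)‖ ≤ 2 := by
      refine (norm_sub_le _ _).trans ?_
      rw [← Complex.ofReal_mul, Complex.norm_exp_ofReal_mul_I]
      norm_num
    have h2 : (-(σ * p.1)).re = -σ.re * p.1 := by simp
    rw [h2, mul_one, mul_comm 2]
    gcongr
  have hinner : ∀ x : ℝ, ∫ t in Set.Ioi (0 : ℝ),
      Complex.exp (-(σ * t)) * (1 - Complex.exp (t * x * Complex.I)) =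
        1 / σ - 1 / (σ - x * Complex.I) := by
    intro x
    have e1 : (-σ).re < 0 := by simpa using hσ
    have e2 : (-(σ - x * Complex.I)).re < 0 := by simpa using hσ
    have h : ∀ t : ℝ, Complex.exp (-(σ * t)) * (1 - Complex.exp (t * x * Complex.I)) =
        Complex.exp (-σ * t) - Complex.exp (-(σ - x * Complex.I) * t) := by
      intro t
      rw [mul_sub, ← Complex.exp_add]
      ring_nf
    simp_rw [h]
    rw [integral_sub (integrableOn_exp_mul_complex_Ioi e1 0) (integrableOn_exp_mul_complex_Ioi e2 0),
      integral_exp_mul_complex_Ioi e1, integral_exp_mul_complex_Ioi e2]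
    rw [Complex.ofReal_zero, mul_zero, mul_zero, Complex.exp_zero, neg_div_neg_eq, neg_div_neg_eq]
  have hswap : ∫ t in Set.Ioi (0 : ℝ), Complex.exp (-(σ * t)) * (1 - charFun ν t) =
      ∫ x : ℝ, (∫ t in Set.Ioi (0 : ℝ),
        Complex.exp (-(σ * t)) * (1 - Complex.exp (t * x * Complex.I))) ∂ν := by
    simp_rw [hchar, ← integral_const_mul]
    exact integral_integral_swap hprod
  have hprod' := hprod.integral_prod_right.const_mul (σ ^ 2)
  simp only [Function.uncurry] at hprod'
  rw [hswap, ← integral_const_mul]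
  have := integral_re hprod'
  simp only [RCLike.re_to_complex] at this
  rw [← this]
  refine integral_nonneg fun x => ?_
  simp only [Pi.zero_apply]
  rw [hinner]
  have hd : σ - x * Complex.I ≠ 0 := by
    intro h
    have := congrArg Complex.re h
    simp at this
    linarith
  -- The real part of the right-hand side is x² Re σ / |σ - ix|².
  have : σ ^ 2 * (1 / σ - 1 / (σ - x * Complex.I)) = -(σ * x * Complex.I) / (σ - x * Complex.I) := by
    field_simp
    ring
  rw [this, Complex.div_re, ← add_div]
  refine div_nonneg ?_ (Complex.normSq_nonneg _)
  simp
  nlinarith [mul_nonneg hσ.le (sq_nonneg x)]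

/-- Once ‖w‖ > 1, the trivial bound 2 is below 2‖w‖. This supplies a dominating function independent
of n. -/
theorem norm_one_sub_exp_le_of_norm_le {w : ℂ} (h : ‖1 - Complex.exp w‖ ≤ 2) :
    ‖1 - Complex.exp w‖ ≤ 2 * ‖w‖ := by
  rcases le_or_gt ‖w‖ 1 with hw | hw
  · rw [norm_sub_rev]
    exact Complex.norm_exp_sub_one_le hw
  · linarith

theorem tendsto_nat_mul_one_sub_exp_div (w : ℂ) :
    Tendsto (fun n : ℕ => (n : ℂ) * (1 - Complex.exp (-w / n))) atTop (𝓝 w) := by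
  have hd : HasDerivAt (fun z : ℂ => Complex.exp (-w * z)) (-w) 0 := by
    simpa using ((hasDerivAt_id (0 : ℂ)).const_mul (-w)).cexp
  have hn : Tendsto (fun n : ℕ => (n : ℂ)⁻¹) atTop (𝓝[≠] 0) :=
    tendsto_nhdsWithin_iff.2 ⟨tendsto_inv_atTop_nhds_zero_nat (𝕜 := ℂ), by
      filter_upwards [eventually_ne_atTop 0] with n hn
      simpa using hn⟩
  have h := (hd.tendsto_slope_zero.comp hn).neg
  rw [neg_neg] at h
  refine h.congr fun n => ?_
  simp [div_eq_mul_inv]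
  ring

/-- If `exp (-c t ^ α)`, `t ≥ 0`, is a characteristic function, then `c σ ^ (1 - α)` has
nonnegative real part for all `σ` in the right half-plane. -/
theorem re_mul_cpow_nonneg_of_charFun_eq (ν : Measure ℝ) [IsProbabilityMeasure ν] {α : ℝ}
    (hα : 0 < α) {c : ℂ}
    (h : ∀ t : ℝ, 0 ≤ t → charFun ν t = Complex.exp (-c * ((t ^ α : ℝ) : ℂ)))
    {σ : ℂ} (hσ : 0 < σ.re) : 0 ≤ (c * σ ^ (1 - α : ℂ)).re := by
  have hσ0 : σ ≠ 0 := by rintro rfl; simp at hσ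
  -- Scaling by n^{-1/α} divides the exponent c t^α by n, so n (1 - φ) tends to c t^α. For n = 0 the
  -- default values agree: both `r 0` and `0⁻¹` vanish.
  set r : ℕ → ℝ := fun n => (n : ℝ) ^ (-(1 / α)) with hr
  have hrα : ∀ n : ℕ, r n ^ α = (n : ℝ)⁻¹ := by
    intro n
    rw [hr, ← Real.rpow_mul n.cast_nonneg, ← Real.rpow_neg_one]
    congr 1
    field_simp
  have hr0 : ∀ n, 0 ≤ r n := fun n => Real.rpow_nonneg n.cast_nonneg _
  have hval : ∀ (n : ℕ) (t : ℝ), 0 < t → charFun (ν.map (r n * ·)) t =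
      Complex.exp (-(c * ((t ^ α : ℝ) : ℂ)) / n) := by
    intro n t ht
    rw [charFun_map_mul, h _ (mul_nonneg (hr0 n) ht.le), Real.mul_rpow (hr0 n) ht.le, hrα]
    congr 1
    push_cast
    ring
  have hnonneg : ∀ n : ℕ, 0 ≤ (σ ^ 2 * ∫ t in Set.Ioi (0 : ℝ),
      Complex.exp (-(σ * t)) * (n * (1 - charFun (ν.map (r n * ·)) t))).re := by
    intro n
    have : IsProbabilityMeasure (ν.map (r n * ·)) :=
      Measure.isProbabilityMeasure_map (by fun_prop)
    have h1 := re_sq_mul_laplace_one_sub_charFun_nonneg (ν.map (r n * ·)) hσ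
    have h2 : ∀ t : ℝ, Complex.exp (-(σ * t)) * (n * (1 - charFun (ν.map (r n * ·)) t)) =
        n * (Complex.exp (-(σ * t)) * (1 - charFun (ν.map (r n * ·)) t)) := fun t => by ring
    simp_rw [h2]
    rw [integral_const_mul, mul_left_comm]
    have h3 := mul_nonneg (Nat.cast_nonneg (α := ℝ) n) h1
    rwa [← Complex.re_ofReal_mul, Complex.ofReal_natCast] at h3
  have hlim : Tendsto (fun n : ℕ => ∫ t in Set.Ioi (0 : ℝ),
      Complex.exp (-(σ * t)) * (n * (1 - charFun (ν.map (r n * ·)) t))) atTop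
      (𝓝 (∫ t in Set.Ioi (0 : ℝ), Complex.exp (-(σ * t)) * (c * ((t ^ α : ℝ) : ℂ)))) := by
    refine tendsto_integral_of_dominated_convergence
      (fun t => 2 * ‖c‖ * (t ^ α * Real.exp (-(σ.re * t)))) (fun n => ?_) ?_ (fun n => ?_) ?_
    · have : IsProbabilityMeasure (ν.map (r n * ·)) :=
        Measure.isProbabilityMeasure_map (by fun_prop)
      exact Measurable.aestronglyMeasurable (by fun_prop)
    · exact (integrableOn_rpow_mul_exp_neg_mul_Ioi (by linarith) hσ).const_mul _
    · have : IsProbabilityMeasure (ν.map (r n * ·)) :=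
        Measure.isProbabilityMeasure_map (by fun_prop)
      filter_upwards [ae_restrict_mem measurableSet_Ioi] with t ht
      have ht' : 0 ≤ t ^ α := Real.rpow_nonneg (le_of_lt ht) α
      have h2 : ‖1 - charFun (ν.map (r n * ·)) t‖ ≤ 2 := norm_one_sub_charFun_le_two
      rw [hval n t ht] at h2 ⊢
      have h3 := norm_one_sub_exp_le_of_norm_le h2
      rw [norm_mul, norm_mul, Complex.norm_exp]
      have h4 : (-(σ * t)).re = -(σ.re * t) := by simp
      rw [h4]
      have h5 : ‖(n : ℂ)‖ * ‖1 - Complex.exp (-(c * ((t ^ α : ℝ) : ℂ)) / n)‖ ≤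
          2 * (‖c‖ * t ^ α) := by
        rcases Nat.eq_zero_or_pos n with rfl | hn
        · simp; positivity
        · have hn' : (0 : ℝ) < n := by exact_mod_cast hn
          rw [norm_div, norm_neg, norm_mul, Complex.norm_real, Real.norm_of_nonneg ht',
            Complex.norm_natCast] at h3
          rw [Complex.norm_natCast]
          calc _ ≤ (n : ℝ) * (2 * (‖c‖ * t ^ α / n)) := by gcongr
            _ = _ := by field_simp
      calc _ ≤ Real.exp (-(σ.re * t)) * (2 * (‖c‖ * t ^ α)) := by gcongr
        _ = _ := by ring
    · filter_upwards [ae_restrict_mem measurableSet_Ioi] with t ht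
      refine Tendsto.const_mul _ ?_
      simp_rw [hval _ t ht]
      exact tendsto_nat_mul_one_sub_exp_div _
  have hlim' := (Complex.continuous_re.tendsto _).comp (hlim.const_mul (σ ^ 2))
  have hge := ge_of_tendsto' hlim' hnonneg
  have heq : σ ^ 2 * ∫ t in Set.Ioi (0 : ℝ), Complex.exp (-(σ * t)) * (c * ((t ^ α : ℝ) : ℂ)) =
      (Real.Gamma (α + 1) : ℂ) * (c * σ ^ (1 - α : ℂ)) := by
    have h2 : ∀ t : ℝ, Complex.exp (-(σ * t)) * (c * ((t ^ α : ℝ) : ℂ)) =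
        c * (((t ^ α : ℝ) : ℂ) * Complex.exp (-(σ * t))) := fun t => by ring
    simp_rw [h2]
    rw [integral_const_mul, integral_rpow_mul_cexp_neg_mul_Ioi hα hσ]
    have : σ ^ (1 - α : ℂ) = σ ^ 2 * σ ^ (-(α + 1 : ℂ)) := by
      rw [← Complex.cpow_ofNat, ← Complex.cpow_add _ _ hσ0]
      congr 1
      ring
    rw [this]
    ring
  rw [heq, Complex.re_ofReal_mul] at hge
  exact nonneg_of_mul_nonneg_right hge (Real.Gamma_pos_of_pos (by linarith))

theorem abs_le_mul_abs_tan_of_charFun_eq (ν : Measure ℝ) [IsProbabilityMeasure ν] {α : ℝ}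
    (hα : 0 < α) (hα2 : α ≤ 2) (hα1 : α ≠ 1) {κ μ : ℝ}
    (h : ∀ t : ℝ, 0 ≤ t → charFun ν t =
      Complex.exp (-((κ : ℂ) - Complex.I * μ) * ((t ^ α : ℝ) : ℂ))) :
    |μ| ≤ κ * |Real.tan (Real.pi * α / 2)| := by
  have hpi := Real.pi_pos
  -- For σ = e^{iω} this is Re(c σ^{1-α}). The closed condition extends to ω = ±π/2, where it reads
  -- κ sin(πα/2) ± μ cos(πα/2) ≥ 0.
  have hω : ∀ ω ∈ Set.Ioo (-(Real.pi / 2)) (Real.pi / 2),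
      0 ≤ κ * Real.cos ((1 - α) * ω) + μ * Real.sin ((1 - α) * ω) := by
    intro ω hω
    have hσ : 0 < (Complex.exp (ω * Complex.I)).re := by
      rw [Complex.exp_ofReal_mul_I_re]
      exact Real.cos_pos_of_mem_Ioo hω
    have h1 := re_mul_cpow_nonneg_of_charFun_eq ν hα h hσ
    have h2 : Complex.exp (ω * Complex.I) ^ (1 - α : ℂ) =
        Complex.exp (((1 - α) * ω : ℝ) * Complex.I) := by
      rw [Complex.cpow_def_of_ne_zero (Complex.exp_ne_zero _), Complex.log_exp]
      · congr 1
        push_cast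
        ring
      · simp; linarith [hω.1]
      · simp; linarith [hω.2]
    rw [h2, Complex.mul_re, Complex.exp_ofReal_mul_I_re, Complex.exp_ofReal_mul_I_im] at h1
    simp at h1
    linarith
  have hcl : ∀ ω ∈ Set.Icc (-(Real.pi / 2)) (Real.pi / 2),
      0 ≤ κ * Real.cos ((1 - α) * ω) + μ * Real.sin ((1 - α) * ω) := by
    intro ω hω'
    rw [← closure_Ioo (by linarith)] at hω'
    exact closure_minimal (t := {ω | 0 ≤ κ * Real.cos ((1 - α) * ω) + μ * Real.sin ((1 - α) * ω)})
      hω (isClosed_le continuous_const (by fun_prop)) hω'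
  have hp := hcl (Real.pi / 2) ⟨by linarith, le_rfl⟩
  have hm := hcl (-(Real.pi / 2)) ⟨le_rfl, by linarith⟩
  have e1 : (1 - α) * (Real.pi / 2) = Real.pi / 2 - Real.pi * α / 2 := by ring
  rw [mul_neg, Real.cos_neg, Real.sin_neg] at hm
  rw [e1, Real.cos_pi_div_two_sub, Real.sin_pi_div_two_sub] at hp hm
  have hs : 0 ≤ Real.sin (Real.pi * α / 2) :=
    Real.sin_nonneg_of_nonneg_of_le_pi (by positivity) (by nlinarith)
  have hc : Real.cos (Real.pi * α / 2) ≠ 0 := by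
    rcases lt_or_gt_of_ne hα1 with hlt | hgt
    · exact (Real.cos_pos_of_mem_Ioo ⟨by nlinarith, by nlinarith⟩).ne'
    · exact (Real.cos_neg_of_pi_div_two_lt_of_lt (by nlinarith) (by nlinarith)).ne
  rw [Real.tan_eq_sin_div_cos, abs_div, abs_of_nonneg hs, ← mul_div_assoc,
    le_div_iff₀ (abs_pos.2 hc), ← abs_mul, abs_le]
  constructor <;> linarith

/-! ### From the expansion to convergence in distribution. -/

theorem isLittleO_sub_one_sub_mul_rpow_iff {f : ℝ → ℂ} {α : ℝ} {c : ℂ} :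
    ((fun t : ℝ => f t - (1 - c * ((t ^ α : ℝ) : ℂ))) =o[𝓝[>] (0 : ℝ)] fun t : ℝ => t ^ α) ↔
      Tendsto (fun t : ℝ => (f t - 1) / ((t ^ α : ℝ) : ℂ)) (𝓝[>] 0) (𝓝 (-c)) := by
  have hne : ∀ᶠ t : ℝ in 𝓝[>] 0, ((t ^ α : ℝ) : ℂ) ≠ 0 := by
    filter_upwards [self_mem_nhdsWithin] with t ht
    exact_mod_cast (Real.rpow_pos_of_pos ht α).ne'
  rw [← isLittleO_norm_right]
  simp_rw [← Complex.norm_real (_ ^ α)]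
  rw [isLittleO_norm_right, isLittleO_iff_tendsto' (hne.mono fun t ht h => absurd h ht),
    tendsto_zero_iff_norm_tendsto_zero]
  refine Iff.trans ?_ tendsto_iff_norm_sub_tendsto_zero.symm
  refine tendsto_congr' (hne.mono fun t ht => ?_)
  have e : (f t - 1) / ((t ^ α : ℝ) : ℂ) - -c =
      (f t - (1 - c * ((t ^ α : ℝ) : ℂ))) / ((t ^ α : ℝ) : ℂ) := by
    field_simp
    ring
  simp only [e]

theorem charFun_map_sum_range_div {Ω : Type*} [MeasurableSpace Ω] {P : Measure Ω}
    {X : ℕ → Ω → ℝ} (hindep : iIndepFun X P) (hident : ∀ i, IdentDistrib (X i) (X 0) P P)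
    (n : ℕ) (a t : ℝ) :
    charFun (P.map fun ω => (∑ i ∈ Finset.range n, X i ω) / a) t =
      charFun (P.map (X 0)) (a⁻¹ * t) ^ n := by
  have mX i := (hident i).aemeasurable_fst
  simp_rw [div_eq_inv_mul]
  rw [charFun_map_mul_comp, (hindep.restrict _).charFun_map_fun_finsetSum_eq_prod (fun _ _ => mX _)]
  · simp [fun i => (hident i).map_eq]
  · exact Finset.aemeasurable_fun_sum _ fun _ _ => mX _

theorem rpow_one_div_inv_mul_rpow {α : ℝ} (hα : 0 < α) (n : ℕ) {t : ℝ} (ht : 0 ≤ t) :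
    (((n : ℝ) ^ (1 / α))⁻¹ * t) ^ α = t ^ α / n := by
  rw [Real.mul_rpow (by positivity) ht, Real.inv_rpow (by positivity),
    ← Real.rpow_mul n.cast_nonneg, one_div_mul_cancel hα.ne', Real.rpow_one, div_eq_inv_mul]

theorem tendsto_rpow_one_div_inv_mul {α : ℝ} (hα : 0 < α) (t : ℝ) :
    Tendsto (fun n : ℕ => ((n : ℝ) ^ (1 / α))⁻¹ * t) atTop (𝓝 0) := by
  have : Tendsto (fun n : ℕ => ((n : ℝ) ^ (1 / α))⁻¹) atTop (𝓝 0) :=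
    ((tendsto_rpow_atTop (one_div_pos.2 hα)).comp tendsto_natCast_atTop_atTop).inv_tendsto_atTop
  simpa using this.mul_const t

/-- At s = n^{-1/α} t one has s^α = t^α / n, so n (f(s) - 1) → -c t^α, and (1 + z_n/n)^n → e^z when
z_n → z. -/
theorem tendsto_pow_of_expansion {f : ℝ → ℂ} (hf0 : f 0 = 1) {α : ℝ} (hα : 0 < α) {c : ℂ}
    (hf : (fun t : ℝ => f t - (1 - c * ((t ^ α : ℝ) : ℂ))) =o[𝓝[>] (0 : ℝ)] fun t : ℝ => t ^ α)
    {t : ℝ} (ht : 0 ≤ t) :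
    Tendsto (fun n : ℕ => f (((n : ℝ) ^ (1 / α))⁻¹ * t) ^ n) atTop
      (𝓝 (Complex.exp (-c * ((t ^ α : ℝ) : ℂ)))) := by
  rcases ht.eq_or_lt with rfl | ht
  · simp [hf0, Real.zero_rpow hα.ne']
  have h := isLittleO_sub_one_sub_mul_rpow_iff.1 hf
  have hs : Tendsto (fun n : ℕ => ((n : ℝ) ^ (1 / α))⁻¹ * t) atTop (𝓝[>] 0) := by
    refine tendsto_nhdsWithin_iff.2 ⟨tendsto_rpow_one_div_inv_mul hα t, ?_⟩
    filter_upwards [eventually_gt_atTop 0] with n hn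
    have : (0 : ℝ) < n := by exact_mod_cast hn
    exact mul_pos (by positivity) ht
  have h1 : Tendsto (fun n : ℕ => (n : ℂ) * (f (((n : ℝ) ^ (1 / α))⁻¹ * t) - 1)) atTop
      (𝓝 (-c * ((t ^ α : ℝ) : ℂ))) := by
    refine ((h.comp hs).mul_const ((t ^ α : ℝ) : ℂ)).congr' ?_
    filter_upwards [eventually_gt_atTop 0] with n hn
    have hn' : (n : ℂ) ≠ 0 := by exact_mod_cast hn.ne'
    have ht' : ((t ^ α : ℝ) : ℂ) ≠ 0 := by exact_mod_cast (Real.rpow_pos_of_pos ht α).ne'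
    simp only [Function.comp_apply, rpow_one_div_inv_mul_rpow hα n ht.le]
    push_cast
    field_simp
  simpa using Complex.tendsto_one_add_pow_exp_of_tendsto h1

/-- The function equal to `exp (-c t ^ α)` for `t ≥ 0`, extended to a Hermitian function. -/
noncomputable def hermitianExpRpow (c : ℂ) (α t : ℝ) : ℂ :=
  if 0 ≤ t then Complex.exp (-c * ((t ^ α : ℝ) : ℂ))
  else (starRingEnd ℂ) (Complex.exp (-c * (((-t) ^ α : ℝ) : ℂ)))

/-- Continuity at 0 is all that Lévy's theorem asks of the limit; both branches tend to 1 there. -/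
theorem continuousAt_hermitianExpRpow (c : ℂ) {α : ℝ} (hα : 0 < α) :
    ContinuousAt (hermitianExpRpow c α) 0 := by
  have h1 : Continuous fun t : ℝ => Complex.exp (-c * ((t ^ α : ℝ) : ℂ)) := by
    have := Real.continuous_rpow_const hα.le
    fun_prop
  have h2 : Continuous fun t : ℝ => (starRingEnd ℂ) (Complex.exp (-c * (((-t) ^ α : ℝ) : ℂ))) :=
    Complex.continuous_conj.comp (h1.comp continuous_neg)
  have e : hermitianExpRpow c α 0 = 1 := by simp [hermitianExpRpow, Real.zero_rpow hα.ne']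
  rw [ContinuousAt, e]
  refine Tendsto.if' ?_ ?_
  · simpa [Real.zero_rpow hα.ne'] using h1.tendsto 0
  · simpa [Real.zero_rpow hα.ne'] using h2.tendsto 0

theorem tendsto_charFun_pow_of_expansion (ν : Measure ℝ) [IsProbabilityMeasure ν] {α : ℝ}
    (hα : 0 < α) {c : ℂ}
    (hf : (fun t : ℝ => charFun ν t - (1 - c * ((t ^ α : ℝ) : ℂ))) =o[𝓝[>] (0 : ℝ)]
      fun t : ℝ => t ^ α) (t : ℝ) :
    Tendsto (fun n : ℕ => charFun ν (((n : ℝ) ^ (1 / α))⁻¹ * t) ^ n) atTop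
      (𝓝 (hermitianExpRpow c α t)) := by
  have h0 : charFun ν 0 = 1 := by simp
  unfold hermitianExpRpow
  split_ifs with ht
  · exact tendsto_pow_of_expansion h0 hα hf ht
  · have h := tendsto_pow_of_expansion h0 hα hf (t := -t) (by linarith)
    refine ((Complex.continuous_conj.tendsto _).comp h).congr fun n => ?_
    rw [Function.comp_apply, map_pow, mul_neg, charFun_neg, Complex.conj_conj]

/-- **Lévy's continuity theorem**, including the existence of the limit law. -/
theorem exists_tendsto_of_tendsto_charFun {ρ : ℕ → ProbabilityMeasure ℝ} {f : ℝ → ℂ}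
    (hf : ContinuousAt f 0)
    (h : ∀ t, Tendsto (fun n => charFun (ρ n : Measure ℝ) t) atTop (𝓝 (f t))) :
    ∃ ν : ProbabilityMeasure ℝ, Tendsto ρ atTop (𝓝 ν) ∧ ∀ t, charFun (ν : Measure ℝ) t = f t := by
  -- Continuity of f at 0 prevents mass from escaping, and Prokhorov's theorem gives a cluster
  -- point. Its characteristic function must be f, so the whole sequence converges to it.
  have htight : IsTightMeasureSet
      {((μ : ProbabilityMeasure ℝ) : Measure ℝ) | μ ∈ Set.range ρ} := by
    refine (isTightMeasureSet_of_tendsto_charFun hf h).subset ?_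
    rintro _ ⟨_, ⟨n, rfl⟩, rfl⟩
    exact ⟨n, rfl⟩
  obtain ⟨ν, -, hν⟩ := (isCompact_closure_of_isTightMeasureSet htight).exists_mapClusterPt
    (f := atTop) (u := ρ) (tendsto_principal.2 (Eventually.of_forall fun n =>
      subset_closure (Set.mem_range_self n)))
  have hchar : ∀ t, charFun (ν : Measure ℝ) t = f t := by
    intro t
    have hc : Continuous fun μ : ProbabilityMeasure ℝ => charFun (μ : Measure ℝ) t := by
      rw [continuous_iff_continuousAt]
      intro μ
      have := (ProbabilityMeasure.tendsto_iff_forall_integral_rclike_tendsto ℂ).1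
        (tendsto_id (α := ProbabilityMeasure ℝ) (x := 𝓝 μ))
      simp_rw [ContinuousAt, charFun_eq_integral_innerProbChar]
      exact this _
    have h1 : MapClusterPt (charFun (ν : Measure ℝ) t) atTop
        (fun n => charFun (ρ n : Measure ℝ) t) :=
      hν.continuousAt_comp hc.continuousAt
    exact eq_of_nhds_neBot ((h1.clusterPt.neBot).mono (inf_le_inf_left _ (h t)))
  refine ⟨ν, ProbabilityMeasure.tendsto_of_tendsto_charFun fun t => ?_, hchar⟩
  rw [hchar]
  exact h t

/-! ### Degenerate laws and the positivity of κ. -/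

theorem norm_charFun_eq_one_of_degenerate {Ω : Type*} [MeasurableSpace Ω] {P : Measure Ω}
    [IsProbabilityMeasure P] {Z : Ω → ℝ} {a : ℝ} (h : Z =ᵐ[P] fun _ => a) (t : ℝ) :
    ‖charFun (P.map Z) t‖ = 1 := by
  rw [Measure.map_congr h, Measure.map_const, measure_univ, one_smul, charFun_dirac]
  simp [Complex.norm_exp]

/-- A probability measure whose characteristic function has modulus one everywhere is a Dirac
mass. -/
theorem exists_ae_eq_of_norm_charFun_eq_one (ν : Measure ℝ) [IsProbabilityMeasure ν]
    (h : ∀ t, ‖charFun ν t‖ = 1) : ∃ a : ℝ, ∀ᵐ x ∂ν, x = a := by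
  -- Symmetrisation: for independent Z, Z' with law ν, the difference Z - Z' has characteristic
  -- function |φ|² = 1, hence vanishes a.s.; Fubini then fixes one of the two variables.
  have hneg : IsProbabilityMeasure (ν.map (-1 * ·)) := Measure.isProbabilityMeasure_map (by fun_prop)
  have hconv : ν ∗ ν.map (-1 * ·) = Measure.dirac 0 := by
    refine Measure.ext_of_charFun ?_
    ext t
    rw [charFun_conv, charFun_map_mul, neg_one_mul, charFun_neg, Complex.mul_conj,
      Complex.normSq_eq_norm_sq, h, charFun_dirac]
    simp
  have h1 : ∀ᵐ z ∂(ν ∗ ν.map (-1 * ·)), z = 0 := by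
    rw [hconv, ae_dirac_eq]
    simp
  rw [Measure.conv, ae_map_iff (p := fun z : ℝ => z = 0) (by fun_prop) (measurableSet_singleton 0)] at h1
  have h2 := Measure.ae_ae_of_ae_prod h1
  obtain ⟨a, ha⟩ := h2.exists
  rw [ae_map_iff (by fun_prop) (measurableSet_eq_fun (by fun_prop) (by fun_prop))] at ha
  exact ⟨a, ha.mono fun x hx => by linarith⟩

/-- Since |φ(t)| = exp(-Re c · |t|^α) ≤ 1, Re c ≥ 0; if Re c = 0, then |φ| = 1 everywhere and the
law is a point mass. -/
theorem re_pos_of_charFun_eq {ν : Measure ℝ} [IsProbabilityMeasure ν] {α : ℝ} {c : ℂ}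
    (hnd : ∀ a : ℝ, ¬ ∀ᵐ x ∂ν, x = a)
    (h : ∀ t : ℝ, 0 ≤ t → charFun ν t = Complex.exp (-c * ((t ^ α : ℝ) : ℂ))) : 0 < c.re := by
  have hnorm : ∀ t : ℝ, 0 ≤ t → ‖charFun ν t‖ = Real.exp (-(c.re * t ^ α)) := by
    intro t ht
    rw [h t ht, Complex.norm_exp, Complex.re_mul_ofReal, Complex.neg_re, neg_mul]
  have h1 : 0 ≤ c.re := by
    have := norm_charFun_le_one (μ := ν) (t := (1 : ℝ))
    rw [hnorm 1 zero_le_one, Real.exp_le_one_iff] at this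
    simpa using this
  refine h1.lt_of_ne fun h0 => ?_
  have hone : ∀ t, ‖charFun ν t‖ = 1 := by
    intro t
    rcases le_total 0 t with ht | ht
    · simp [hnorm t ht, ← h0]
    · have := hnorm (-t) (by linarith)
      rw [charFun_neg, RCLike.norm_conj] at this
      simp [this, ← h0]
  obtain ⟨a, ha⟩ := exists_ae_eq_of_norm_charFun_eq_one ν hone
  exact hnd a ha

/-! ### From convergence in distribution to the expansion. -/

/-- The truncation at 2 makes the integrand bounded and continuous, so the modulus of continuity
passes to weak limits. -/
theorem norm_charFun_sub_charFun_le (ν : Measure ℝ) [IsProbabilityMeasure ν] {s t h : ℝ}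
    (hst : |s - t| ≤ h) : ‖charFun ν s - charFun ν t‖ ≤ ∫ x, min 2 (h * |x|) ∂ν := by
  have hint : ∀ s : ℝ, Integrable (fun x : ℝ => Complex.exp (s * x * Complex.I)) ν := fun s =>
    (integrable_const (1 : ℝ)).mono' (by fun_prop) (ae_of_all _ fun x => by
      rw [← Complex.ofReal_mul, Complex.norm_exp_ofReal_mul_I])
  have hh : 0 ≤ h := (abs_nonneg _).trans hst
  rw [charFun_apply_real, charFun_apply_real, ← integral_sub (hint s) (hint t)]
  refine norm_integral_le_of_norm_le ?_ (ae_of_all _ fun x => le_min ?_ ?_)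
  · refine (integrable_const (2 : ℝ)).mono' (by fun_prop) (ae_of_all _ fun x => ?_)
    rw [Real.norm_of_nonneg (le_min zero_le_two (by positivity))]
    exact min_le_left _ _
  · refine (norm_sub_le _ _).trans ?_
    rw [← Complex.ofReal_mul, ← Complex.ofReal_mul, Complex.norm_exp_ofReal_mul_I,
      Complex.norm_exp_ofReal_mul_I]
    norm_num
  · have e : Complex.exp (s * x * Complex.I) - Complex.exp (t * x * Complex.I) =
        Complex.exp ((t * x : ℝ) * Complex.I) *
          (Complex.exp (Complex.I * ((s - t) * x : ℝ)) - 1) := by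
      rw [mul_sub, ← Complex.exp_add, mul_one]
      push_cast
      ring_nf
    rw [e, norm_mul, Complex.norm_exp_ofReal_mul_I, one_mul]
    refine Real.norm_exp_I_mul_ofReal_sub_one_le.trans ?_
    rw [Real.norm_eq_abs, abs_mul]
    gcongr

/-- The characteristic functions of a weakly convergent sequence are asymptotically uniformly
equicontinuous. -/
theorem exists_eventually_norm_charFun_sub_le {ρ : ℕ → ProbabilityMeasure ℝ}
    {ν : ProbabilityMeasure ℝ} (hρ : Tendsto ρ atTop (𝓝 ν)) {ε : ℝ} (hε : 0 < ε) :
    ∃ δ > 0, ∀ᶠ n in atTop, ∀ s t : ℝ, |s - t| ≤ δ →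
      ‖charFun (ρ n : Measure ℝ) s - charFun (ρ n : Measure ℝ) t‖ ≤ ε := by
  have hbd : ∀ h : ℝ, 0 ≤ h → ∀ x : ℝ, ‖min 2 (h * |x|)‖ ≤ 2 := fun h hh x => by
    rw [Real.norm_of_nonneg (le_min zero_le_two (by positivity))]
    exact min_le_left _ _
  have hlim : Tendsto (fun k : ℕ => ∫ x, min 2 (1 / ((k : ℝ) + 1) * |x|) ∂(ν : Measure ℝ)) atTop
      (𝓝 (∫ _, (0 : ℝ) ∂(ν : Measure ℝ))) := by
    refine tendsto_integral_of_dominated_convergence (fun _ => 2) (fun k => by fun_prop)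
      (integrable_const _) (fun k => ae_of_all _ fun x => hbd _ (by positivity) x)
      (ae_of_all _ fun x => ?_)
    have h1 := (tendsto_one_div_add_atTop_nhds_zero_nat (𝕜 := ℝ)).mul_const |x|
    simpa using (tendsto_const_nhds (x := (2 : ℝ))).min h1
  rw [integral_zero] at hlim
  obtain ⟨k, hk⟩ := (hlim.eventually (gt_mem_nhds hε)).exists
  set h : ℝ := 1 / ((k : ℝ) + 1) with hh
  have hpos : 0 < h := by positivity
  refine ⟨h, hpos, ?_⟩
  -- The scale h was chosen for the limit law alone; weak convergence tested on F carries the strict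
  -- bound to all large n.
  let F : BoundedContinuousFunction ℝ ℝ :=
    BoundedContinuousFunction.ofNormedAddCommGroup (fun x => min 2 (h * |x|)) (by fun_prop) 2
      (hbd h hpos.le)
  have hF := (ProbabilityMeasure.tendsto_iff_forall_integral_tendsto.1 hρ) F
  filter_upwards [hF.eventually (gt_mem_nhds (show ∫ x, F x ∂(ν : Measure ℝ) < ε from hk))]
    with n hn s t hst
  exact (norm_charFun_sub_charFun_le _ hst).trans hn.le

theorem mem_slitPlane_of_norm_sub_one_lt_one {z : ℂ} (h : ‖z - 1‖ < 1) : z ∈ Complex.slitPlane := by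
  simpa using Complex.mem_slitPlane_of_norm_lt_one h

/-- Both sides are continuous lifts of f^n through the covering map exp on an interval, and both
vanish at 0; lifts are unique. -/
theorem nat_mul_log_eq_log_pow {f : ℝ → ℂ} (hf : Continuous f) (hf0 : f 0 = 1) {δ : ℝ} {n : ℕ}
    (h1 : ∀ t ∈ Set.Icc 0 δ, f t ∈ Complex.slitPlane)
    (h2 : ∀ t ∈ Set.Icc 0 δ, f t ^ n ∈ Complex.slitPlane) {t : ℝ} (ht : t ∈ Set.Icc 0 δ) :
    n * Complex.log (f t) = Complex.log (f t ^ n) := by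
  refine Complex.isCoveringMap_exp.eqOn_of_comp_eqOn
    (g₁ := fun t => n * Complex.log (f t)) (g₂ := fun t => Complex.log (f t ^ n))
    isPreconnected_Icc ?_ ?_ (fun x hx => ?_)
    (Set.left_mem_Icc.2 (ht.1.trans ht.2)) (by simp [hf0]) ht
  · exact continuousOn_const.mul (hf.continuousOn.clog h1)
  · exact (hf.pow n).continuousOn.clog h2
  · refine Subtype.ext ?_
    change Complex.exp (n * Complex.log (f x)) = Complex.exp (Complex.log (f x ^ n))
    rw [Complex.exp_nat_mul, Complex.exp_log (Complex.slitPlane_ne_zero (h1 x hx)),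
      Complex.exp_log (Complex.slitPlane_ne_zero (h2 x hx))]

/-- Multiply by (e^w - 1)/w → 1 at w = log f(s); `dslope` also covers w = 0. -/
theorem tendsto_sub_one_div_of_tendsto_log_div {l : Filter ℝ} {f g : ℝ → ℂ} {a : ℂ}
    (hf : Tendsto f l (𝓝 1)) (h : Tendsto (fun s => Complex.log (f s) / g s) l (𝓝 a)) :
    Tendsto (fun s => (f s - 1) / g s) l (𝓝 a) := by
  have hlog : Tendsto (fun s => Complex.log (f s)) l (𝓝 0) := by
    simpa using hf.clog Complex.one_mem_slitPlane
  have hd : Tendsto (dslope Complex.exp 0) (𝓝 0) (𝓝 1) := by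
    have := (continuousAt_dslope_same.2 (Complex.differentiableAt_exp (x := 0))).tendsto
    simpa [dslope_same] using this
  have hm := h.mul (hd.comp hlog)
  rw [mul_one] at hm
  refine hm.congr' ?_
  filter_upwards [hf.eventually_ne one_ne_zero] with s hs
  have := sub_smul_dslope Complex.exp 0 (Complex.log (f s))
  rw [sub_zero, smul_eq_mul, Complex.exp_log hs, Complex.exp_zero] at this
  rw [Function.comp_apply, div_mul_eq_mul_div, this]

theorem exists_expansion_of_tendsto {ν : Measure ℝ} [IsProbabilityMeasure ν] {α : ℝ} (hα : 0 < α)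
    {ρ : ℕ → ProbabilityMeasure ℝ} {ρ' : ProbabilityMeasure ℝ} (hρ : Tendsto ρ atTop (𝓝 ρ'))
    (hchar : ∀ (n : ℕ) (t : ℝ),
      charFun (ρ n : Measure ℝ) t = charFun ν (((n : ℝ) ^ (1 / α))⁻¹ * t) ^ n) :
    ∃ c : ℂ, (fun t : ℝ => charFun ν t - (1 - c * ((t ^ α : ℝ) : ℂ))) =o[𝓝[>] (0 : ℝ)]
      fun t : ℝ => t ^ α := by
  have hcont : Continuous (charFun ν) := continuous_charFun
  have hone : Tendsto (charFun ν) (𝓝 0) (𝓝 1) := by simpa using hcont.tendsto 0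
  -- The radius 1/2 keeps the characteristic functions, and their limit at δ, in the slit plane on
  -- an interval independent of n.
  obtain ⟨δ, hδ, hev⟩ := exists_eventually_norm_charFun_sub_le hρ (ε := 1 / 2) (by norm_num)
  have hnear : ∀ᶠ n in atTop, ∀ t ∈ Set.Icc 0 δ, ‖charFun (ρ n : Measure ℝ) t - 1‖ ≤ 1 / 2 := by
    filter_upwards [hev] with n hn t ht
    simpa using hn t 0 (by rw [sub_zero, abs_of_nonneg ht.1]; exact ht.2)
  obtain ⟨η, hη, hηs⟩ : ∃ η > 0, ∀ s : ℝ, |s| < η → ‖charFun ν s - 1‖ < 1 := by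
    obtain ⟨η, hη, h⟩ := Metric.tendsto_nhds_nhds.1 hone 1 one_pos
    refine ⟨η, hη, fun s hs => ?_⟩
    rw [← dist_eq_norm]
    exact h (by simpa using hs)
  have hlog : ∀ᶠ n : ℕ in atTop, ∀ t ∈ Set.Icc 0 δ,
      n * Complex.log (charFun ν (((n : ℝ) ^ (1 / α))⁻¹ * t)) =
        Complex.log (charFun (ρ n : Measure ℝ) t) := by
    filter_upwards [hnear, (tendsto_rpow_one_div_inv_mul hα δ).eventually (gt_mem_nhds hη)]
      with n hn hnη t ht
    rw [hchar]
    refine nat_mul_log_eq_log_pow (f := fun t => charFun ν (((n : ℝ) ^ (1 / α))⁻¹ * t)) (δ := δ)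
      (by fun_prop) (by simp) (fun x hx => ?_) (fun x hx => ?_) ht
    · refine mem_slitPlane_of_norm_sub_one_lt_one (hηs _ ?_)
      have h0 : 0 ≤ ((n : ℝ) ^ (1 / α))⁻¹ := by positivity
      rw [abs_of_nonneg (mul_nonneg h0 hx.1)]
      exact (mul_le_mul_of_nonneg_left hx.2 h0).trans_lt hnη
    · refine mem_slitPlane_of_norm_sub_one_lt_one ?_
      rw [← hchar]
      exact (hn x hx).trans_lt (by norm_num)
  have hlimδ : Tendsto (fun n => charFun (ρ n : Measure ℝ) δ) atTop
      (𝓝 (charFun (ρ' : Measure ℝ) δ)) := ProbabilityMeasure.tendsto_iff_tendsto_charFun.1 hρ δ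
  have hslit : charFun (ρ' : Measure ℝ) δ ∈ Complex.slitPlane := by
    refine mem_slitPlane_of_norm_sub_one_lt_one (lt_of_le_of_lt (b := 1 / 2) ?_ (by norm_num))
    exact le_of_tendsto (hlimδ.sub_const 1).norm
      (hnear.mono fun n hn => hn δ ⟨hδ.le, le_rfl⟩)
  have hy : Tendsto (fun s : ℝ => (δ / s) ^ α) (𝓝[>] 0) atTop := by
    refine (tendsto_rpow_atTop hα).comp ?_
    exact (tendsto_inv_nhdsGT_zero.const_mul_atTop hδ).congr fun s => (div_eq_mul_inv _ _).symm
  -- Rounding down keeps the point t = N^{1/α} s in [0, δ], while t → δ as s ↓ 0.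
  set N : ℝ → ℕ := fun s => ⌊(δ / s) ^ α⌋₊ with hN
  have hNtop : Tendsto N (𝓝[>] 0) atTop := tendsto_nat_floor_atTop.comp hy
  have hq : Tendsto (fun s => (N s : ℝ) / (δ / s) ^ α) (𝓝[>] 0) (𝓝 1) :=
    tendsto_nat_floor_div_atTop.comp hy
  have hT : Tendsto (fun s => (N s : ℝ) ^ (1 / α) * s) (𝓝[>] 0) (𝓝 δ) := by
    have h := (hq.rpow_const (p := 1 / α) (Or.inl one_ne_zero)).mul_const δ
    rw [Real.one_rpow, one_mul] at h
    refine h.congr' ?_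
    filter_upwards [self_mem_nhdsWithin] with s hs
    have hs' : 0 < δ / s := div_pos hδ hs
    rw [Real.div_rpow (Nat.cast_nonneg _) (by positivity), ← Real.rpow_mul hs'.le,
      mul_one_div_cancel hα.ne', Real.rpow_one]
    have : s ≠ 0 := ne_of_gt hs
    field_simp
  have hTmem : ∀ᶠ s : ℝ in 𝓝[>] 0, (N s : ℝ) ^ (1 / α) * s ∈ Set.Icc 0 δ := by
    filter_upwards [self_mem_nhdsWithin] with s hs
    have hs0 : (0 : ℝ) < s := hs
    have hs' : 0 < δ / s := div_pos hδ hs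
    refine ⟨by positivity, ?_⟩
    rw [← le_div_iff₀ hs0]
    calc (N s : ℝ) ^ (1 / α) ≤ ((δ / s) ^ α) ^ (1 / α) := by
          gcongr
          exact Nat.floor_le (by positivity)
      _ = δ / s := by rw [← Real.rpow_mul hs'.le, mul_one_div_cancel hα.ne', Real.rpow_one]
  -- Both the index and the point move with s; equicontinuity allows the point to be replaced by δ.
  have hcomp : Tendsto (fun s => charFun (ρ (N s) : Measure ℝ) ((N s : ℝ) ^ (1 / α) * s)) (𝓝[>] 0)
      (𝓝 (charFun (ρ' : Measure ℝ) δ)) := by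
    have hdiff : Tendsto (fun s => charFun (ρ (N s) : Measure ℝ) ((N s : ℝ) ^ (1 / α) * s) -
        charFun (ρ (N s) : Measure ℝ) δ) (𝓝[>] 0) (𝓝 0) := by
      rw [NormedAddGroup.tendsto_nhds_zero]
      intro ε hε
      obtain ⟨r, hr, hrn⟩ := exists_eventually_norm_charFun_sub_le hρ (half_pos hε)
      filter_upwards [hNtop.eventually hrn, hT.eventually (Metric.closedBall_mem_nhds δ hr)]
        with s h1 h2
      exact (h1 _ _ (by simpa [Real.dist_eq] using h2)).trans_lt (half_lt_self hε)
    simpa using hdiff.add (hlimδ.comp hNtop)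
  have hmain : Tendsto (fun s : ℝ => (N s : ℂ) * Complex.log (charFun ν s)) (𝓝[>] 0)
      (𝓝 (Complex.log (charFun (ρ' : Measure ℝ) δ))) := by
    refine (hcomp.clog hslit).congr' ?_
    filter_upwards [hNtop.eventually hlog, hTmem, hNtop.eventually (eventually_gt_atTop 0)]
      with s h1 h2 h3
    rw [← h1 _ h2]
    have : (0 : ℝ) < N s := by exact_mod_cast h3
    rw [inv_mul_cancel_left₀ (by positivity)]
  have hq' : Tendsto (fun s => ((((N s : ℝ) / (δ / s) ^ α * δ ^ α)⁻¹ : ℝ) : ℂ)) (𝓝[>] 0)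
      (𝓝 (((1 * δ ^ α)⁻¹ : ℝ) : ℂ)) :=
    (Complex.continuous_ofReal.tendsto _).comp
      ((hq.mul_const (δ ^ α)).inv₀ (by positivity))
  -- Here N s^α → δ^α and N log φ(s) → log φ_Z(δ), so log φ(s) / s^α → log φ_Z(δ) / δ^α = -c.
  refine ⟨-(Complex.log (charFun (ρ' : Measure ℝ) δ) * (((1 * δ ^ α)⁻¹ : ℝ) : ℂ)),
    isLittleO_sub_one_sub_mul_rpow_iff.2 ?_⟩
  rw [neg_neg]
  refine tendsto_sub_one_div_of_tendsto_log_div (hone.mono_left nhdsWithin_le_nhds) ?_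
  refine (hmain.mul hq').congr' ?_
  filter_upwards [self_mem_nhdsWithin, hNtop.eventually (eventually_gt_atTop 0)] with s hs hs3
  have hs0 : (0 : ℝ) < s := hs
  have hn : (N s : ℂ) ≠ 0 := by exact_mod_cast hs3.ne'
  have hsα : ((s ^ α : ℝ) : ℂ) ≠ 0 := by exact_mod_cast (Real.rpow_pos_of_pos hs0 α).ne'
  have hδα : ((δ ^ α : ℝ) : ℂ) ≠ 0 := by exact_mod_cast (Real.rpow_pos_of_pos hδ α).ne'
  rw [Real.div_rpow hδ.le hs0.le]
  rw [Complex.ofReal_inv, Complex.ofReal_mul, Complex.ofReal_div, Complex.ofReal_div,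
    Complex.ofReal_natCast]
  field_simp

/-! ### Strict stability and the main theorem. -/

/-- The exponent is homogeneous of degree α, so φ(t)^n = φ(n^{1/α} t) for t ≥ 0; conjugation gives t
< 0. -/
theorem isStableWith_of_charFun_eq {ν : Measure ℝ} [IsProbabilityMeasure ν] {α : ℝ} (hα : 0 < α)
    {c : ℂ} (hnd : IsNondegenerate (fun x : ℝ => x) ν)
    (h : ∀ t : ℝ, 0 ≤ t → charFun ν t = Complex.exp (-c * ((t ^ α : ℝ) : ℂ))) :
    IsStableWith ν (fun n => (n : ℝ) ^ (1 / α)) (fun _ => 0) where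
  nondegenerate := hnd
  pos n hn := by
    have : (0 : ℝ) < n := by exact_mod_cast hn
    positivity
  sum_law n _ := by
    have h1 : IsProbabilityMeasure (iidSumLaw ν n) :=
      Measure.isProbabilityMeasure_map (by fun_prop)
    have hmap : ν.map (fun x => (n : ℝ) ^ (1 / α) * x + 0) = ν.map ((n : ℝ) ^ (1 / α) * ·) := by
      simp
    rw [hmap]
    have h2 : IsProbabilityMeasure (ν.map ((n : ℝ) ^ (1 / α) * ·)) :=
      Measure.isProbabilityMeasure_map (by fun_prop)
    have hnonneg : ∀ t : ℝ, 0 ≤ t →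
        charFun ν t ^ n = charFun ν ((n : ℝ) ^ (1 / α) * t) := by
      intro t ht
      rw [h t ht, h _ (by positivity), ← Complex.exp_nat_mul, Real.mul_rpow (by positivity) ht,
        ← Real.rpow_mul n.cast_nonneg, one_div_mul_cancel hα.ne', Real.rpow_one]
      push_cast
      ring_nf
    refine Measure.ext_of_charFun (funext fun t => ?_)
    rw [iidSumLaw, charFun_map_sum_pi_eq_prod, charFun_map_mul, Finset.prod_const, Finset.card_univ,
      Fintype.card_fin, Pi.pow_apply]
    rcases le_total 0 t with ht | ht
    · exact hnonneg t ht
    · have := congrArg (starRingEnd ℂ) (hnonneg (-t) (by linarith))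
      rwa [map_pow, mul_neg, charFun_neg, charFun_neg, Complex.conj_conj, Complex.conj_conj] at this

theorem isNondegenerate_iff_map {Ω : Type*} [MeasurableSpace Ω] {P : Measure Ω} {Z : Ω → ℝ}
    (hZ : AEMeasurable Z P) : IsNondegenerate Z P ↔ IsNondegenerate (fun x : ℝ => x) (P.map Z) := by
  refine forall_congr' fun a => not_congr ?_
  exact (ae_map_iff (p := fun x : ℝ => x = a) hZ (measurableSet_singleton a)).symm

theorem charFun_eq_of_tendstoInDistribution {Ω Ω' : Type*} [MeasurableSpace Ω]
    [MeasurableSpace Ω'] {P : Measure Ω} [IsProbabilityMeasure P] {P' : Measure Ω'}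
    [IsProbabilityMeasure P'] {X : ℕ → Ω → ℝ} {Z : Ω' → ℝ} (hindep : iIndepFun X P)
    (hident : ∀ i, IdentDistrib (X i) (X 0) P P) {α : ℝ} (hα : 0 < α)
    (hZ : TendstoInDistribution
      (fun (n : ℕ) ω => (∑ i ∈ Finset.range n, X i ω) / (n : ℝ) ^ (1 / α)) atTop Z (fun _ => P) P')
    {c : ℂ} (hf : (fun t : ℝ => charFun (P.map (X 0)) t - (1 - c * ((t ^ α : ℝ) : ℂ)))
      =o[𝓝[>] (0 : ℝ)] fun t : ℝ => t ^ α) {t : ℝ} (ht : 0 ≤ t) :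
    charFun (P'.map Z) t = Complex.exp (-c * ((t ^ α : ℝ) : ℂ)) := by
  have : IsProbabilityMeasure (P.map (X 0)) :=
    Measure.isProbabilityMeasure_map (hident 0).aemeasurable_fst
  have h1 := ProbabilityMeasure.tendsto_iff_tendsto_charFun.1 hZ.tendsto t
  simp only [ProbabilityMeasure.coe_mk, charFun_map_sum_range_div hindep hident] at h1
  exact tendsto_nhds_unique h1 (tendsto_pow_of_expansion (by simp) hα hf ht)

theorem mainTheorem1 {Ω : Type*} [MeasurableSpace Ω] (P : Measure Ω) [IsProbabilityMeasure P]
    (X : ℕ → Ω → ℝ) (hindep : iIndepFun X P) (hident : ∀ i, IdentDistrib (X i) (X 0) P P)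
    (α : ℝ) (hα0 : 0 < α) (hα2 : α ≤ 2) :
    ((∃ (Ω' : Type) (_ : MeasurableSpace Ω') (P' : Measure Ω') (_ : IsProbabilityMeasure P')
        (Z : Ω' → ℝ), IsNondegenerate Z P' ∧
          TendstoInDistribution
            (fun (n : ℕ) ω => (∑ i ∈ Finset.range n, X i ω) / (n : ℝ) ^ (1 / α))
            atTop Z (fun _ => P) P') ↔
      ∃ κ μ : ℝ, 0 < κ ∧ HasCharFunExpansion (X 0) P α κ μ) ∧
    ∀ {Ω' : Type*} [MeasurableSpace Ω'] (P' : Measure Ω') [IsProbabilityMeasure P']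
      (Z : Ω' → ℝ), IsNondegenerate Z P' →
        TendstoInDistribution
          (fun (n : ℕ) ω => (∑ i ∈ Finset.range n, X i ω) / (n : ℝ) ^ (1 / α))
          atTop Z (fun _ => P) P' →
        ∀ κ μ : ℝ, 0 < κ → HasCharFunExpansion (X 0) P α κ μ →
          IsStrictlyStable Z P' α ∧
          (∀ t : ℝ, 0 ≤ t → charFun (P'.map Z) t =
            Complex.exp (-((κ : ℂ) - Complex.I * μ) * ((t ^ α : ℝ) : ℂ))) ∧
          (α ≠ 1 → |μ| ≤ κ * |Real.tan (Real.pi * α / 2)|) := by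
  have hX : ∀ i, AEMeasurable (X i) P := fun i => (hident i).aemeasurable_fst
  have : IsProbabilityMeasure (P.map (X 0)) := Measure.isProbabilityMeasure_map (hX 0)
  have hS : ∀ n : ℕ, AEMeasurable
      (fun ω => (∑ i ∈ Finset.range n, X i ω) / (n : ℝ) ^ (1 / α)) P := fun n =>
    (Finset.aemeasurable_fun_sum _ fun i _ => hX i).div_const _
  refine ⟨⟨?_, ?_⟩, ?_⟩
  · rintro ⟨Ω', _, P', _, Z, hnd, hZ⟩
    have hZm := hZ.aemeasurable_limit
    have : IsProbabilityMeasure (P'.map Z) := Measure.isProbabilityMeasure_map hZm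
    obtain ⟨c, hc⟩ := exists_expansion_of_tendsto hα0 hZ.tendsto
      fun n t => charFun_map_sum_range_div hindep hident n _ t
    refine ⟨c.re, -c.im, re_pos_of_charFun_eq ((isNondegenerate_iff_map hZm).1 hnd) fun t ht =>
      charFun_eq_of_tendstoInDistribution hindep hident hα0 hZ hc ht, ?_⟩
    have e : (c.re : ℂ) - Complex.I * ((-c.im : ℝ) : ℂ) = c := by
      apply Complex.ext <;> simp
    rw [HasCharFunExpansion, e]
    exact hc
  · rintro ⟨κ, μ, hκ, hf⟩
    set c : ℂ := (κ : ℂ) - Complex.I * μ with hc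
    obtain ⟨ν, hν, hchar⟩ := exists_tendsto_of_tendsto_charFun
      (ρ := fun n => ⟨P.map fun ω => (∑ i ∈ Finset.range n, X i ω) / (n : ℝ) ^ (1 / α),
        Measure.isProbabilityMeasure_map (hS n)⟩)
      (continuousAt_hermitianExpRpow c hα0) fun t => by
        simp only [ProbabilityMeasure.coe_mk, charFun_map_sum_range_div hindep hident]
        exact tendsto_charFun_pow_of_expansion _ hα0 hf t
    refine ⟨ℝ, inferInstance, (ν : Measure ℝ), inferInstance, id, fun a ha => ?_, hS,
      aemeasurable_id, ?_⟩
    · have h1 := norm_charFun_eq_one_of_degenerate ha 1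
      rw [Measure.map_id, hchar, hermitianExpRpow, if_pos zero_le_one, Complex.norm_exp] at h1
      simp [hc, hκ.ne'] at h1
    · convert hν using 2
      exact congrArg 𝓝 (Subtype.ext Measure.map_id)
  · intro Ω' _ P' _ Z hnd hZ κ μ _ hf
    have hZm := hZ.aemeasurable_limit
    have : IsProbabilityMeasure (P'.map Z) := Measure.isProbabilityMeasure_map hZm
    have hchar : ∀ t : ℝ, 0 ≤ t → charFun (P'.map Z) t =
        Complex.exp (-((κ : ℂ) - Complex.I * μ) * ((t ^ α : ℝ) : ℂ)) := fun t ht =>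
      charFun_eq_of_tendstoInDistribution hindep hident hα0 hZ hf ht
    exact ⟨isStableWith_of_charFun_eq hα0 ((isNondegenerate_iff_map hZm).1 hnd) hchar, hchar,
      fun hα1 => abs_le_mul_abs_tan_of_charFun_eq _ hα0 hα2 hα1 hchar⟩
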